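/- For $n>1$ let $\mathcal{L}_n$ be the set of Littlewood polynomials of degree $n-1$, i.e. polynomials of degree $n-1$ with all coefficients in $\{1,-1\}$. Let $\mathcal{R}_n=\{f\in\mathcal{L}_n : f(z)=z^{n-1}f(z^{-1})\}$ be the reciprocal ones and, for even $n$, let $\mathcal{N}_n=\{f\in\mathcal{L}_n : f(z)=-z^{n-1}f(z^{-1})\}$ be the negative reciprocal ones. For a polynomial $f$ write $\|f\|_4=\big(\frac{1}{2\pi}\int_0^{2\pi}|f(e^{i\theta})|^4\,d\theta\big)^{1/4}$. Theorem 3. Let $n>1$ and let $f$ be drawn uniformly at random from $\mathcal{R}_n$, or (for even $n$) from $\mathcal{N}_n$. Then $$\mathbb{E}\big(\|f\|_4^4\big)=3n^2-3n+\frac{1-(-1)^n}{2},$$ $$\mathrm{Var}\big(\|f\|_4^4\big)=\begin{cases}32n^3-216n^2+304n+256\left\lfloor\frac{n}{6}\right\rfloor+256\cdot I[n \bmod 6=4] & \text{for } n \text{ even},\\[1ex] 32n^3-144n^2+160n-576\left\lfloor\frac{n-1}{4}\right\rfloor-512\left\lfloor\frac{n-1}{6}\right\rfloor-48 & \text{for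 } n \text{ odd},\end{cases}$$ where $I[\,\cdot\,]$ is $1$ if the condition holds and $0$ otherwise. -/

import Mathlib

open Polynomial MeasureTheory ProbabilityTheory

noncomputable section

namespace LittlewoodL4

/-- The `L_p` norm of a complex polynomial on the unit circle,
`‖f‖_p = ((1 / 2π) ∫_0^{2π} |f(e^{iθ})|^p dθ)^{1/p}`, for real `p > 0`. -/
def lpNorm (p : ℝ) (f : ℂ[X]) : ℝ :=
  (1 / (2 * Real.pi) *
    ∫ θ in (0 : ℝ)..(2 * Real.pi), ‖f.eval (Complex.exp (Complex.I * (θ : ℂ)))‖ ^ p) ^ (1 / p)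

/-- Littlewood polynomials: polynomials of degree `n - 1` all of whose coefficients
are `1` or `-1`. -/
def littlewood (n : ℕ) : Set ℂ[X] :=
  {f | f.natDegree + 1 = n ∧ ∀ j < n, f.coeff j = 1 ∨ f.coeff j = -1}

/-- Reciprocal Littlewood polynomials: `f(z) = z^{n-1} f(z⁻¹)`. -/
def reciprocal (n : ℕ) : Set ℂ[X] :=
  {f | f ∈ littlewood n ∧ ∀ z : ℂ, z ≠ 0 → f.eval z = z ^ (n - 1) * f.eval z⁻¹}

/-- Negative reciprocal Littlewood polynomials: `n` is even and `f(z) = -z^{n-1} f(z⁻¹)`. -/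
def negReciprocal (n : ℕ) : Set ℂ[X] :=
  {f | f ∈ littlewood n ∧ Even n ∧
    ∀ z : ℂ, z ≠ 0 → f.eval z = -(z ^ (n - 1) * f.eval z⁻¹)}

/-- Polynomials carry the discrete σ-algebra (only uniform laws on finite sets are used). -/
instance instMeasurableSpacePolynomial : MeasurableSpace ℂ[X] := ⊤

instance instDiscreteMeasurableSpacePolynomial : DiscreteMeasurableSpace ℂ[X] :=
  ⟨fun _ => trivial⟩

end LittlewoodL4

end

/-! On the unit circle a real palindromic f satisfies |f|² = z^{-(n-1)} f², so ‖f‖₄⁴ is the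
coefficient of z^{2(n-1)} in f⁴ (`lpNorm_four_pow_of_reflect`). Writing f = ∑ εᵢ pᵢ with free signs
εᵢ and palindromic pᵢ (`mirror`) turns this into a quartic form in independent signs. Its mean is
the Walsh coefficient at ∅. By Parseval (`sum_quartic_sq`) its variance is the sum of the squares of
the other coefficients, which live on sets of size 2 and 4.

The sets of size 4 never have to be counted. Their coefficients c are 0 or 48
(`walshCoeff_mirror_four`), so c² = 48c. The sum of all coefficients is the value at ε = 1, where f
= 1 + z + ... + z^{n-1} and the form equals n(2n² + 1)/3. Hence the variance is the sum of c(c - 48)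
over pairs, plus 48 times the difference between this value and the mean (`sum_sq_walshCoeff`).

The pair coefficients are explicit. They depend on parities and on whether the centred exponents
n-1-2i and n-1-2j have ratio 3; counting these pairs produces the floor terms. The negative
reciprocal case follows from f(z) ↦ f(-z), which preserves the norm. -/

namespace LittlewoodL4

/-! ### Walsh functions on the sign cube. -/

section SignSums

variable {ι : Type*} [Fintype ι] [DecidableEq ι]

/-- The Walsh function of `T` on the sign cube. -/
def walsh (T : Finset ι) (ε : ι → ℤˣ) : ℤ := ∏ i ∈ T, (ε i : ℤ)

lemma units_coe_mul_self (u : ℤˣ) : (u : ℤ) * u = 1 := by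
  rcases Int.units_eq_one_or u with rfl | rfl <;> simp

omit [Fintype ι] in
lemma walsh_mul_walsh (S T : Finset ι) (ε : ι → ℤˣ) :
    walsh S ε * walsh T ε = walsh (symmDiff S T) ε := by
  have hS : walsh S ε = walsh (S \ T) ε * walsh (S ∩ T) ε := by
    simp only [walsh]
    rw [← Finset.prod_union (Finset.disjoint_sdiff_inter S T), Finset.sdiff_union_inter]
  have hT : walsh T ε = walsh (T \ S) ε * walsh (S ∩ T) ε := by
    simp only [walsh]
    rw [Finset.inter_comm, ← Finset.prod_union (Finset.disjoint_sdiff_inter T S),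
      Finset.sdiff_union_inter]
  have hI : walsh (S ∩ T) ε * walsh (S ∩ T) ε = 1 := by
    simp only [walsh, ← Finset.prod_mul_distrib, units_coe_mul_self, Finset.prod_const_one]
  have hU : walsh (symmDiff S T) ε = walsh (S \ T) ε * walsh (T \ S) ε := by
    rw [walsh, show symmDiff S T = S \ T ∪ T \ S from rfl,
      Finset.prod_union disjoint_sdiff_sdiff]
    rfl
  rw [hS, hT, hU]
  linear_combination walsh (S \ T) ε * walsh (T \ S) ε * hI

/-- Reversal of the sign at `i`. -/
def flipSign (i : ι) (ε : ι → ℤˣ) : ι → ℤˣ := ε * Pi.mulSingle i (-1)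

omit [Fintype ι] in
lemma flipSign_self (i : ι) (ε : ι → ℤˣ) : flipSign i ε i = -ε i := by
  simp [flipSign]

omit [Fintype ι] in
lemma flipSign_of_ne {i j : ι} (h : j ≠ i) (ε : ι → ℤˣ) : flipSign i ε j = ε j := by
  simp [flipSign, Pi.mulSingle_eq_of_ne h]

lemma sum_flipSign {M : Type*} [AddCommMonoid M] (i : ι) (F : (ι → ℤˣ) → M) :
    ∑ ε, F (flipSign i ε) = ∑ ε, F ε :=
  Equiv.sum_comp (Equiv.mulRight (Pi.mulSingle i (-1))) F

/-- Flipping one sign inside a nonempty `T` negates the Walsh function, so the sum equals its own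
negative. -/
lemma sum_walsh (T : Finset ι) :
    ∑ ε : ι → ℤˣ, walsh T ε = if T = ∅ then 2 ^ Fintype.card ι else 0 := by
  split_ifs with h
  · simp [h, walsh]
  · obtain ⟨i, hi⟩ := Finset.nonempty_iff_ne_empty.mpr h
    have h1 : ∑ ε : ι → ℤˣ, walsh T ε = -∑ ε : ι → ℤˣ, walsh T ε := by
      rw [← Finset.sum_neg_distrib, ← sum_flipSign i]
      refine Finset.sum_congr rfl fun ε _ => ?_
      rw [walsh, walsh, ← Finset.mul_prod_erase _ _ hi, ← Finset.mul_prod_erase _ _ hi,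
        flipSign_self, Finset.prod_congr rfl fun j hj => by
          rw [flipSign_of_ne (Finset.ne_of_mem_erase hj)]]
      simp
    omega

/-- The indices that a tuple takes an odd number of times. -/
def oddFibre {k : ℕ} (q : Fin k → ι) : Finset ι :=
  Finset.univ.filter fun i => Odd (Finset.univ.filter fun j => q j = i).card

lemma prod_eq_walsh_oddFibre {k : ℕ} (q : Fin k → ι) (ε : ι → ℤˣ) :
    ∏ j, (ε (q j) : ℤ) = walsh (oddFibre q) ε := by
  rw [walsh, oddFibre, Finset.prod_filter,
    ← Finset.prod_fiberwise_of_maps_to (s := Finset.univ) (t := Finset.univ) (g := q)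
      (fun _ _ => Finset.mem_univ _)]
  refine Finset.prod_congr rfl fun i _ => ?_
  rw [Finset.prod_congr rfl (g := fun _ => (ε i : ℤ)) fun j hj => by
    rw [(Finset.mem_filter.mp hj).2], Finset.prod_const]
  have h2 : ((ε i : ℤ)) ^ 2 = 1 := by rw [sq, units_coe_mul_self]
  split_ifs with h
  · obtain ⟨m, hm⟩ := h
    rw [hm, pow_succ, pow_mul, h2, one_pow, one_mul]
  · obtain ⟨m, hm⟩ := Nat.not_odd_iff_even.mp h
    rw [hm, ← two_mul, pow_mul, h2, one_pow]

lemma card_oddFibre_le {k : ℕ} (q : Fin k → ι) : (oddFibre q).card ≤ k := by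
  have : oddFibre q ⊆ Finset.univ.image q := by
    intro i hi
    have h := (Finset.mem_filter.mp hi).2.pos
    obtain ⟨j, hj⟩ := Finset.card_pos.mp h
    exact Finset.mem_image.mpr ⟨j, Finset.mem_univ _, (Finset.mem_filter.mp hj).2⟩
  exact (Finset.card_le_card this).trans (Finset.card_image_le.trans (by simp))

lemma odd_card_oddFibre {k : ℕ} (q : Fin k → ι) : Odd (oddFibre q).card ↔ Odd k := by
  rw [oddFibre, ← Finset.odd_sum_iff_odd_card_odd,
    ← Finset.card_eq_sum_card_fiberwise (fun _ _ => Finset.mem_univ _)]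
  simp

/-! ### Walsh expansion of a quartic form. -/

variable {A : Type*} [CommRing A]

/-- The random sum `∑ εᵢ pᵢ`. -/
def signSum (p : ι → A) (ε : ι → ℤˣ) : A := ∑ i, ((ε i : ℤ) : A) * p i

/-- The Walsh coefficient at `T` of the quartic form `ε ↦ L ((∑ εᵢ pᵢ) ^ 4)`. -/
def walshCoeff (L : A →+ ℤ) (p : ι → A) (T : Finset ι) : ℤ :=
  ∑ q : Fin 4 → ι, if oddFibre q = T then L (∏ j, p (q j)) else 0

/-- Expand the fourth power over 4-tuples of indices: squared signs disappear, so the sign of a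
tuple depends only on its odd fibre. -/
lemma quartic_eq_sum_walsh (L : A →+ ℤ) (p : ι → A) (ε : ι → ℤˣ) :
    L (signSum p ε ^ 4) = ∑ T, walshCoeff L p T * walsh T ε := by
  have h1 : ∀ q : Fin 4 → ι, L (∏ j, ((ε (q j) : ℤ) : A) * p (q j)) =
      L (∏ j, p (q j)) * walsh (oddFibre q) ε := by
    intro q
    rw [Finset.prod_mul_distrib, ← Int.cast_prod, prod_eq_walsh_oddFibre, ← zsmul_eq_mul,
      map_zsmul, smul_eq_mul, mul_comm]
  rw [signSum, Fintype.sum_pow, map_sum]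
  simp only [h1, walshCoeff, Finset.sum_mul, ite_mul, zero_mul]
  rw [Finset.sum_comm]
  simp

lemma quartic_one_eq_sum_walshCoeff (L : A →+ ℤ) (p : ι → A) :
    L ((∑ i, p i) ^ 4) = ∑ T, walshCoeff L p T := by
  have := quartic_eq_sum_walsh L p 1
  simpa [signSum, walsh] using this

lemma sum_walsh_mul_quartic (L : A →+ ℤ) (p : ι → A) (T : Finset ι) :
    ∑ ε, walsh T ε * L (signSum p ε ^ 4) = 2 ^ Fintype.card ι * walshCoeff L p T := by
  simp only [quartic_eq_sum_walsh, Finset.mul_sum]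
  rw [Finset.sum_comm, Finset.sum_eq_single T]
  · simp only [mul_left_comm (walsh T _), walsh_mul_walsh, ← Finset.mul_sum]
    simp [sum_walsh, mul_comm]
  · intro S _ hS
    simp only [mul_left_comm (walsh T _), walsh_mul_walsh, ← Finset.mul_sum]
    rw [sum_walsh, if_neg, mul_zero]
    simpa [symmDiff_eq_bot] using hS.symm
  · simp

lemma sum_quartic_sq (L : A →+ ℤ) (p : ι → A) :
    ∑ ε, L (signSum p ε ^ 4) ^ 2 = 2 ^ Fintype.card ι * ∑ T, walshCoeff L p T ^ 2 := by
  have : ∀ ε, L (signSum p ε ^ 4) ^ 2 =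
      ∑ T, walshCoeff L p T * (walsh T ε * L (signSum p ε ^ 4)) := by
    intro ε
    rw [sq]
    nth_rw 1 [quartic_eq_sum_walsh]
    simp only [Finset.sum_mul, mul_assoc]
  simp only [this]
  rw [Finset.sum_comm]
  simp only [← Finset.mul_sum, sum_walsh_mul_quartic]
  rw [Finset.mul_sum]
  exact Finset.sum_congr rfl fun T _ => by ring

/-- The odd fibre of a 4-tuple has even size at most 4. -/
lemma walshCoeff_eq_zero (L : A →+ ℤ) (p : ι → A) {T : Finset ι}
    (h0 : T ≠ ∅) (h2 : T.card ≠ 2) (h4 : T.card ≠ 4) : walshCoeff L p T = 0 := by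
  refine Finset.sum_eq_zero fun q _ => if_neg ?_
  rintro rfl
  have h1 := card_oddFibre_le q
  have h3 := (odd_card_oddFibre q).not
  have h5 := Finset.card_ne_zero.mpr (Finset.nonempty_iff_ne_empty.mpr h0)
  rw [Nat.odd_iff, Nat.odd_iff] at h3
  omega

/-- If the coefficients of order four lie in `{0, K}`, the variance is determined by
the coefficients of order two, the mean and the value at the all-ones vector. -/
lemma sum_sq_walshCoeff (L : A →+ ℤ) (p : ι → A) (K : ℤ)
    (hK : ∀ T : Finset ι, T.card = 4 → walshCoeff L p T = 0 ∨ walshCoeff L p T = K) :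
    ∑ T, walshCoeff L p T ^ 2 = walshCoeff L p ∅ ^ 2
      + ∑ T ∈ Finset.powersetCard 2 Finset.univ, walshCoeff L p T * (walshCoeff L p T - K)
      + K * (L ((∑ i, p i) ^ 4) - walshCoeff L p ∅) := by
  -- The product c(c - K) vanishes on every set of size 4, so only ∅ and the pairs survive.
  have h : ∑ T, walshCoeff L p T * (walshCoeff L p T - K) =
      walshCoeff L p ∅ * (walshCoeff L p ∅ - K) +
      ∑ T ∈ Finset.powersetCard 2 Finset.univ, walshCoeff L p T * (walshCoeff L p T - K) := by
    have hnot : (∅ : Finset ι) ∉ Finset.powersetCard 2 (Finset.univ : Finset ι) := by simp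
    rw [← Finset.sum_insert (f := fun T => walshCoeff L p T * (walshCoeff L p T - K)) hnot]
    symm
    refine Finset.sum_subset (Finset.subset_univ _) fun T _ hT => ?_
    simp only [Finset.mem_insert, Finset.mem_powersetCard, Finset.subset_univ, true_and,
      not_or] at hT
    by_cases h4 : T.card = 4
    · rcases hK T h4 with h | h <;> simp [h]
    · simp [walshCoeff_eq_zero L p hT.1 hT.2 h4]
  rw [quartic_one_eq_sum_walshCoeff]
  have h' : ∑ T, walshCoeff L p T * (walshCoeff L p T - K) =
      ∑ T, walshCoeff L p T ^ 2 - K * ∑ T, walshCoeff L p T := by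
    rw [Finset.mul_sum, ← Finset.sum_sub_distrib]
    exact Finset.sum_congr rfl fun T _ => by ring
  linear_combination h - h'

/-! ### Walsh coefficients in closed form, by averaging over one sign at a time. -/

lemma signSum_eq_update (p : ι → A) (i : ι) (ε : ι → ℤˣ) :
    signSum p ε = signSum (Function.update p i 0) ε + ((ε i : ℤ) : A) * p i := by
  have h : ∀ j, ((ε j : ℤ) : A) * p j = ((ε j : ℤ) : A) * Function.update p i 0 j
      + if j = i then ((ε i : ℤ) : A) * p i else 0 := by
    intro j
    by_cases hj : j = i
    · subst hj; simp
    · simp [hj]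
  rw [signSum, Finset.sum_congr rfl fun j _ => h j, Finset.sum_add_distrib]
  simp [signSum]

lemma signSum_update_flipSign (p : ι → A) (i : ι) (ε : ι → ℤˣ) :
    signSum (Function.update p i 0) (flipSign i ε) = signSum (Function.update p i 0) ε := by
  refine Finset.sum_congr rfl fun j _ => ?_
  by_cases h : j = i
  · subst h; simp
  · rw [flipSign_of_ne h]

variable [IsDomain A] [CharZero A]

-- Pairing ε with its flip at i extracts the part of (s + εᵢ pᵢ)^k that is odd in pᵢ, where s is the
-- sum without index i. Iterating this peels off the signs of a Walsh function one by one.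
omit [IsDomain A] [CharZero A] in
lemma sum_sign_mul_pow (p : ι → A) (i : ι) (W : (ι → ℤˣ) → A)
    (hW : ∀ ε, W (flipSign i ε) = W ε) (k : ℕ) :
    2 * ∑ ε, W ε * ((ε i : ℤ) : A) * signSum p ε ^ k =
      ∑ ε, W ε * ((signSum (Function.update p i 0) ε + p i) ^ k
        - (signSum (Function.update p i 0) ε - p i) ^ k) := by
  rw [two_mul]
  nth_rw 2 [← sum_flipSign i]
  rw [← Finset.sum_add_distrib]
  refine Finset.sum_congr rfl fun ε _ => ?_
  rw [signSum_eq_update p i, signSum_eq_update p i (flipSign i ε), signSum_update_flipSign,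
    flipSign_self, hW]
  rcases Int.units_eq_one_or (ε i) with h | h <;> rw [h] <;> push_cast <;> ring

lemma sum_sign_mul_pow_one (p : ι → A) (i : ι) (W : (ι → ℤˣ) → A)
    (hW : ∀ ε, W (flipSign i ε) = W ε) :
    ∑ ε, W ε * ((ε i : ℤ) : A) * signSum p ε = (∑ ε, W ε) * p i := by
  have := sum_sign_mul_pow p i W hW 1
  refine mul_left_cancel₀ (two_ne_zero (α := A)) ?_
  simp only [pow_one] at this
  rw [this, Finset.sum_mul, Finset.mul_sum]
  exact Finset.sum_congr rfl fun ε _ => by ring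

lemma sum_sign_mul_pow_two (p : ι → A) (i : ι) (W : (ι → ℤˣ) → A)
    (hW : ∀ ε, W (flipSign i ε) = W ε) :
    ∑ ε, W ε * ((ε i : ℤ) : A) * signSum p ε ^ 2 =
      2 * p i * ∑ ε, W ε * signSum (Function.update p i 0) ε := by
  have := sum_sign_mul_pow p i W hW 2
  refine mul_left_cancel₀ (two_ne_zero (α := A)) ?_
  rw [this, Finset.mul_sum, Finset.mul_sum]
  exact Finset.sum_congr rfl fun ε _ => by ring

lemma sum_sign_mul_pow_three (p : ι → A) (i : ι) (W : (ι → ℤˣ) → A)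
    (hW : ∀ ε, W (flipSign i ε) = W ε) :
    ∑ ε, W ε * ((ε i : ℤ) : A) * signSum p ε ^ 3 =
      3 * p i * (∑ ε, W ε * signSum (Function.update p i 0) ε ^ 2) + (∑ ε, W ε) * p i ^ 3 := by
  have := sum_sign_mul_pow p i W hW 3
  refine mul_left_cancel₀ (two_ne_zero (α := A)) ?_
  rw [this, Finset.mul_sum, Finset.sum_mul, ← Finset.sum_add_distrib, Finset.mul_sum]
  exact Finset.sum_congr rfl fun ε _ => by ring

lemma sum_sign_mul_pow_four (p : ι → A) (i : ι) (W : (ι → ℤˣ) → A)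
    (hW : ∀ ε, W (flipSign i ε) = W ε) :
    ∑ ε, W ε * ((ε i : ℤ) : A) * signSum p ε ^ 4 =
      4 * p i * (∑ ε, W ε * signSum (Function.update p i 0) ε ^ 3)
      + 4 * p i ^ 3 * ∑ ε, W ε * signSum (Function.update p i 0) ε := by
  have := sum_sign_mul_pow p i W hW 4
  refine mul_left_cancel₀ (two_ne_zero (α := A)) ?_
  rw [this, Finset.mul_sum, Finset.mul_sum, ← Finset.sum_add_distrib, Finset.mul_sum]
  exact Finset.sum_congr rfl fun ε _ => by ring

lemma sum_signSum_sq (p : ι → A) :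
    ∑ ε, signSum p ε ^ 2 = 2 ^ Fintype.card ι * ∑ i, p i ^ 2 := by
  have h : ∀ i, ∑ ε : ι → ℤˣ, ((ε i : ℤ) : A) * signSum p ε = 2 ^ Fintype.card ι * p i := by
    intro i
    simpa using sum_sign_mul_pow_one p i (fun _ => 1) (fun _ => rfl)
  have h' : ∀ ε : ι → ℤˣ, signSum p ε ^ 2 = ∑ i, p i * (((ε i : ℤ) : A) * signSum p ε) := by
    intro ε
    rw [sq]
    nth_rw 1 [signSum]
    rw [Finset.sum_mul]
    exact Finset.sum_congr rfl fun i _ => by ring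
  simp only [h']
  rw [Finset.sum_comm]
  simp only [← Finset.mul_sum, h]
  rw [Finset.mul_sum]
  exact Finset.sum_congr rfl fun i _ => by ring

omit [IsDomain A] [CharZero A] in
lemma sum_update_sq (p : ι → A) (i : ι) :
    ∑ k, Function.update p i 0 k ^ 2 = ∑ k, p k ^ 2 - p i ^ 2 := by
  rw [← Finset.add_sum_erase _ _ (Finset.mem_univ i),
    ← Finset.add_sum_erase (a := i) _ (fun k => p k ^ 2) (Finset.mem_univ i),
    Finset.sum_congr rfl fun j hj => by
    rw [Function.update_of_ne (Finset.ne_of_mem_erase hj)]]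
  simp

lemma sum_signSum_pow_four (p : ι → A) :
    ∑ ε, signSum p ε ^ 4 =
      2 ^ Fintype.card ι * (3 * (∑ i, p i ^ 2) ^ 2 - 2 * ∑ i, p i ^ 4) := by
  have h : ∀ i, ∑ ε : ι → ℤˣ, ((ε i : ℤ) : A) * signSum p ε ^ 3 =
      2 ^ Fintype.card ι * (3 * p i * (∑ k, p k ^ 2) - 2 * p i ^ 3) := by
    intro i
    have := sum_sign_mul_pow_three p i (fun _ => 1) (fun _ => rfl)
    simp only [one_mul, sum_signSum_sq, sum_update_sq] at this
    rw [this]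
    simp
    ring
  have h' : ∀ ε : ι → ℤˣ, signSum p ε ^ 4 = ∑ i, p i * (((ε i : ℤ) : A) * signSum p ε ^ 3) := by
    intro ε
    rw [pow_succ']
    nth_rw 1 [signSum]
    rw [Finset.sum_mul]
    exact Finset.sum_congr rfl fun i _ => by ring
  simp only [h']
  rw [Finset.sum_comm]
  simp only [← Finset.mul_sum, h]
  rw [sq (∑ i, p i ^ 2), Finset.sum_mul, Finset.mul_sum, Finset.mul_sum,
    ← Finset.sum_sub_distrib, Finset.mul_sum]
  exact Finset.sum_congr rfl fun i _ => by ring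

lemma sum_sign_sign_signSum_pow_four (p : ι → A) {i j : ι} (hij : i ≠ j) :
    ∑ ε : ι → ℤˣ, ((ε j : ℤ) : A) * ((ε i : ℤ) : A) * signSum p ε ^ 4 =
      2 ^ Fintype.card ι *
        (p i * p j * (12 * ∑ k, p k ^ 2 - 8 * p i ^ 2 - 8 * p j ^ 2)) := by
  have h4 := sum_sign_mul_pow_four p i (fun ε => ((ε j : ℤ) : A))
    (fun ε => by rw [flipSign_of_ne hij.symm])
  have h3 := sum_sign_mul_pow_three (Function.update p i 0) j (fun _ => 1) (fun _ => rfl)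
  have h1 := sum_sign_mul_pow_one (Function.update p i 0) j (fun _ => 1) (fun _ => rfl)
  simp only [one_mul, sum_signSum_sq, sum_update_sq, Function.update_of_ne hij.symm] at h3 h1
  rw [h4, h3, h1]
  simp
  ring

lemma sum_four_signs_signSum_pow_four (p : ι → A) {i j k l : ι}
    (hij : i ≠ j) (hik : i ≠ k) (hil : i ≠ l) (hjk : j ≠ k) (hjl : j ≠ l) (hkl : k ≠ l) :
    ∑ ε : ι → ℤˣ, ((ε l : ℤ) : A) * ((ε k : ℤ) : A) * ((ε j : ℤ) : A) * ((ε i : ℤ) : A)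
        * signSum p ε ^ 4 =
      2 ^ Fintype.card ι * (24 * (p i * p j * p k * p l)) := by
  have h4 := sum_sign_mul_pow_four p i
    (fun ε => ((ε l : ℤ) : A) * ((ε k : ℤ) : A) * ((ε j : ℤ) : A))
    (fun ε => by rw [flipSign_of_ne hij.symm, flipSign_of_ne hik.symm, flipSign_of_ne hil.symm])
  have h3 := sum_sign_mul_pow_three (Function.update p i 0) j
    (fun ε => ((ε l : ℤ) : A) * ((ε k : ℤ) : A))
    (fun ε => by rw [flipSign_of_ne hjk.symm, flipSign_of_ne hjl.symm])
  have h1 := sum_sign_mul_pow_one (Function.update p i 0) j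
    (fun ε => ((ε l : ℤ) : A) * ((ε k : ℤ) : A))
    (fun ε => by rw [flipSign_of_ne hjk.symm, flipSign_of_ne hjl.symm])
  have h2 := sum_sign_mul_pow_two (Function.update (Function.update p i 0) j 0) k
    (fun ε => ((ε l : ℤ) : A)) (fun ε => by rw [flipSign_of_ne hkl.symm])
  have h0 := sum_sign_mul_pow_one
    (Function.update (Function.update (Function.update p i 0) j 0) k 0) l
    (fun _ => 1) (fun _ => rfl)
  -- This removes the terms carrying a cube; what is left is 4 · 3 · 2 · 1 = 24 times the product.
  have hz : ∑ ε : ι → ℤˣ, ((ε l : ℤ) : A) * ((ε k : ℤ) : A) = 0 := by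
    have := sum_walsh ({l, k} : Finset ι)
    simp only [walsh, Finset.prod_pair hkl.symm] at this
    rw [if_neg (by simp)] at this
    exact_mod_cast congrArg (Int.cast : ℤ → A) this
  simp only [one_mul, Function.update_of_ne hij.symm, Function.update_of_ne hik.symm,
    Function.update_of_ne hil.symm, Function.update_of_ne hjk.symm,
    Function.update_of_ne hjl.symm, Function.update_of_ne hkl.symm] at h4 h3 h2 h1 h0
  rw [h4, h3, h1, h2, h0, hz]
  simp
  ring

-- Lets the averages be computed in the ring `A`, with `L` applied only at the end.
omit [IsDomain A] [CharZero A] in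
lemma walshCoeff_eq_of_sum (L : A →+ ℤ) (p : ι → A) (T : Finset ι) (a : A)
    (h : ∑ ε, (walsh T ε : A) * signSum p ε ^ 4 = 2 ^ Fintype.card ι * a) :
    walshCoeff L p T = L a := by
  have h2 : (2 : ℤ) ^ Fintype.card ι ≠ 0 := by positivity
  refine mul_left_cancel₀ h2 ?_
  rw [← sum_walsh_mul_quartic]
  have := congrArg L h
  rw [map_sum, show (2 : A) ^ Fintype.card ι * a = (2 ^ Fintype.card ι : ℤ) • a by
    rw [zsmul_eq_mul]; push_cast; rfl, map_zsmul, smul_eq_mul] at this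
  rw [← this]
  refine Finset.sum_congr rfl fun ε _ => ?_
  rw [← zsmul_eq_mul, map_zsmul, smul_eq_mul]

lemma walshCoeff_empty (L : A →+ ℤ) (p : ι → A) :
    walshCoeff L p ∅ = L (3 * (∑ i, p i ^ 2) ^ 2 - 2 * ∑ i, p i ^ 4) := by
  apply walshCoeff_eq_of_sum
  rw [← sum_signSum_pow_four]
  simp [walsh]

lemma walshCoeff_pair (L : A →+ ℤ) (p : ι → A) {i j : ι} (hij : i ≠ j) :
    walshCoeff L p {i, j} =
      L (p i * p j * (12 * ∑ k, p k ^ 2 - 8 * p i ^ 2 - 8 * p j ^ 2)) := by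
  apply walshCoeff_eq_of_sum
  rw [← sum_sign_sign_signSum_pow_four p hij]
  refine Finset.sum_congr rfl fun ε _ => ?_
  rw [walsh, Finset.prod_pair hij]
  push_cast
  ring

lemma walshCoeff_four (L : A →+ ℤ) (p : ι → A) {i j k l : ι}
    (hij : i ≠ j) (hik : i ≠ k) (hil : i ≠ l) (hjk : j ≠ k) (hjl : j ≠ l) (hkl : k ≠ l) :
    walshCoeff L p {i, j, k, l} = L (24 * (p i * p j * p k * p l)) := by
  apply walshCoeff_eq_of_sum
  rw [← sum_four_signs_signSum_pow_four p hij hik hil hjk hjl hkl]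
  refine Finset.sum_congr rfl fun ε _ => ?_
  rw [walsh, Finset.prod_insert (by simp [hij, hik, hil]),
    Finset.prod_insert (by simp [hjk, hjl]), Finset.prod_pair hkl]
  push_cast
  ring

end SignSums

/-! ### Palindromic building blocks and their central coefficients. -/

section MirrorPolynomials

/-- The coefficient at `2 (n - 1)`, as an additive functional. -/
noncomputable def midCoeff (n : ℕ) : ℤ[X] →+ ℤ :=
  (Polynomial.lcoeff ℤ (2 * (n - 1))).toAddMonoidHom

lemma midCoeff_apply (n : ℕ) (Q : ℤ[X]) : midCoeff n Q = Q.coeff (2 * (n - 1)) := rfl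

lemma midCoeff_X_pow (n a : ℕ) :
    midCoeff n (X ^ a) = if a = 2 * (n - 1) then 1 else 0 := by
  rw [midCoeff_apply, coeff_X_pow]
  exact if_congr eq_comm rfl rfl

lemma midCoeff_X_pow_of_eq {n a : ℕ} (h : a = 2 * (n - 1)) : midCoeff n (X ^ a) = 1 := by
  rw [midCoeff_X_pow, if_pos h]

lemma midCoeff_X_pow_of_ne {n a : ℕ} (h : a ≠ 2 * (n - 1)) : midCoeff n (X ^ a) = 0 := by
  rw [midCoeff_X_pow, if_neg h]

lemma midCoeff_ofNat_mul (n k : ℕ) [k.AtLeastTwo] (Q : ℤ[X]) :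
    midCoeff n (ofNat(k) * Q) = ofNat(k) * midCoeff n Q := by
  simp [midCoeff_apply]

lemma midCoeff_natCast_mul (n k : ℕ) (Q : ℤ[X]) :
    midCoeff n ((k : ℤ[X]) * Q) = k * midCoeff n Q := by
  simp [midCoeff_apply]

lemma midCoeff_reflect (n : ℕ) {a b : ℕ} (h : a + b = 4 * (n - 1)) :
    midCoeff n (X ^ a) = midCoeff n (X ^ b) := by
  rw [midCoeff_X_pow, midCoeff_X_pow]
  exact if_congr (by omega) rfl rfl

/-- The palindromic polynomial spanned by the exponents `i` and `n - 1 - i`. -/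
noncomputable def mirror (n i : ℕ) : ℤ[X] :=
  if 2 * i + 1 = n then X ^ i else X ^ i + X ^ (n - 1 - i)

lemma mirror_center {n i : ℕ} (h : 2 * i + 1 = n) : mirror n i = X ^ i := if_pos h

lemma mirror_of_lt {n i : ℕ} (h : 2 * i + 1 < n) : mirror n i = X ^ i + X ^ (n - 1 - i) :=
  if_neg h.ne

lemma sum_range_fold_even {M : Type*} [AddCommMonoid M] (φ : ℕ → M) (h : ℕ) :
    ∑ e ∈ Finset.range (2 * h), φ e = ∑ i ∈ Finset.range h, (φ i + φ (2 * h - 1 - i)) := by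
  rw [two_mul, Finset.sum_range_add, Finset.sum_add_distrib,
    ← Finset.sum_range_reflect (fun x => φ (h + x))]
  congr 1
  refine Finset.sum_congr rfl fun i hi => ?_
  have := Finset.mem_range.mp hi
  congr 1
  omega

lemma sum_range_fold_odd {M : Type*} [AddCommMonoid M] (φ : ℕ → M) (m : ℕ) :
    ∑ e ∈ Finset.range (2 * m + 1), φ e =
      ∑ i ∈ Finset.range m, (φ i + φ (2 * m - i)) + φ m := by
  rw [show 2 * m + 1 = (m + 1) + m by omega, Finset.sum_range_add, Finset.sum_range_succ,
    Finset.sum_add_distrib, ← Finset.sum_range_reflect (fun x => φ (m + 1 + x)), add_right_comm]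
  congr 2
  refine Finset.sum_congr rfl fun i hi => ?_
  have := Finset.mem_range.mp hi
  congr 1
  omega

lemma sum_mirror (n : ℕ) (hn : 1 < n) :
    ∑ i : Fin ((n + 1) / 2), mirror n i = ∑ e ∈ Finset.range n, X ^ e := by
  rw [Fin.sum_univ_eq_sum_range (fun i => mirror n i)]
  obtain ⟨h, rfl | rfl⟩ := n.even_or_odd'
  · rw [sum_range_fold_even, show (2 * h + 1) / 2 = h by omega]
    refine Finset.sum_congr rfl fun i hi => ?_
    have := Finset.mem_range.mp hi
    rw [mirror_of_lt (by omega)]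
  · rw [sum_range_fold_odd, show (2 * h + 1 + 1) / 2 = h + 1 by omega, Finset.sum_range_succ,
      mirror_center rfl]
    congr 1
    refine Finset.sum_congr rfl fun i hi => ?_
    have := Finset.mem_range.mp hi
    rw [mirror_of_lt (by omega)]
    rfl

/-- The squares of the monomials fill all even exponents; each non-central index adds a cross term 2
X^(n-1), and there are (n - n % 2) / 2 such indices. -/
lemma sum_mirror_sq (n : ℕ) (hn : 1 < n) :
    ∑ i : Fin ((n + 1) / 2), mirror n i ^ 2 =
      ∑ e ∈ Finset.range n, X ^ (2 * e) + ((n - n % 2 : ℕ) : ℤ[X]) * X ^ (n - 1) := by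
  have key : ∀ i, 2 * i + 1 < n →
      mirror n i ^ 2 = X ^ (2 * i) + X ^ (2 * (n - 1 - i)) + 2 * X ^ (n - 1) := by
    intro i hi
    have : (X : ℤ[X]) ^ (n - 1) = X ^ i * X ^ (n - 1 - i) := by
      rw [← pow_add]; congr 1; omega
    rw [mirror_of_lt hi, this]
    ring
  rw [Fin.sum_univ_eq_sum_range (fun i => mirror n i ^ 2)]
  obtain ⟨h, rfl | rfl⟩ := n.even_or_odd'
  · rw [sum_range_fold_even, show (2 * h + 1) / 2 = h by omega,
      Finset.sum_congr rfl fun i hi => key i (by have := Finset.mem_range.mp hi; omega),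
      Finset.sum_add_distrib]
    simp [mul_comm, mul_assoc]
  · rw [sum_range_fold_odd, show (2 * h + 1 + 1) / 2 = h + 1 by omega, Finset.sum_range_succ,
      mirror_center rfl,
      Finset.sum_congr rfl fun i hi => key i (by have := Finset.mem_range.mp hi; omega),
      Finset.sum_add_distrib]
    have : (2 * h + 1) % 2 = 1 := by omega
    simp [this]
    ring

/-- The complementary exponent 2(n-1) - a lies between 0 and 2(n-1), so it occurs in the sum exactly
when it is even. -/
lemma midCoeff_X_pow_mul_sum (n : ℕ) {a : ℕ} (ha : a ≤ 2 * (n - 1)) (hn : 1 < n) :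
    midCoeff n (X ^ a * ∑ e ∈ Finset.range n, X ^ (2 * e)) = if a % 2 = 0 then 1 else 0 := by
  simp only [Finset.mul_sum, ← pow_add, map_sum, midCoeff_X_pow]
  split_ifs with h
  · rw [Finset.sum_eq_single ((2 * (n - 1) - a) / 2)]
    · rw [if_pos (by omega)]
    · intro e _ he
      rw [if_neg (by omega)]
    · intro he
      exact absurd (Finset.mem_range.mpr (by omega)) he
  · exact Finset.sum_eq_zero fun e _ => if_neg (by omega)

lemma midCoeff_mirror_pow_four {n i : ℕ} (h : 2 * i + 1 < n) :
    midCoeff n (mirror n i ^ 4) = 6 := by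
  have : mirror n i ^ 4 = X ^ (4 * i) + 4 * X ^ (3 * i + (n - 1 - i))
      + 6 * X ^ (2 * (n - 1)) + 4 * X ^ (i + 3 * (n - 1 - i)) + X ^ (4 * (n - 1 - i)) := by
    have h2 : (X : ℤ[X]) ^ (2 * (n - 1)) = X ^ (2 * i + 2 * (n - 1 - i)) := by
      congr 1; omega
    rw [mirror_of_lt h, h2]
    ring
  rw [this]
  simp (disch := omega) only [map_add, midCoeff_ofNat_mul, midCoeff_X_pow_of_eq,
    midCoeff_X_pow_of_ne]
  norm_num

lemma midCoeff_sum_mirror_pow_four (n : ℕ) (hn : 1 < n) :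
    midCoeff n (∑ i : Fin ((n + 1) / 2), mirror n i ^ 4) = 3 * n - 2 * (n % 2 : ℕ) := by
  rw [map_sum, Fin.sum_univ_eq_sum_range (fun i => midCoeff n (mirror n i ^ 4))]
  obtain ⟨h, rfl | rfl⟩ := n.even_or_odd'
  · rw [show (2 * h + 1) / 2 = h by omega, Finset.sum_congr rfl fun i hi =>
      midCoeff_mirror_pow_four (by have := Finset.mem_range.mp hi; omega)]
    simp
    ring
  · rw [show (2 * h + 1 + 1) / 2 = h + 1 by omega, Finset.sum_range_succ,
      mirror_center rfl, ← pow_mul, midCoeff_X_pow, if_pos (by omega),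
      Finset.sum_congr rfl fun i hi =>
      midCoeff_mirror_pow_four (by have := Finset.mem_range.mp hi; omega)]
    have : (2 * h + 1) % 2 = 1 := by omega
    simp [this]
    ring

lemma walshCoeff_mirror_empty (n : ℕ) (hn : 1 < n) :
    walshCoeff (midCoeff n) (fun i : Fin ((n + 1) / 2) => mirror n i) ∅ =
      3 * (n : ℤ) ^ 2 - 3 * n + (n % 2 : ℕ) := by
  rw [walshCoeff_empty, map_sub, midCoeff_ofNat_mul, midCoeff_ofNat_mul,
    midCoeff_sum_mirror_pow_four n hn, sum_mirror_sq n hn]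
  set S : ℤ[X] := ∑ e ∈ Finset.range n, X ^ (2 * e) with hS
  have h1 : midCoeff n (S * S) = n := by
    nth_rw 1 [hS]
    rw [Finset.sum_mul, map_sum, Finset.sum_congr rfl fun e he => by
      rw [hS, midCoeff_X_pow_mul_sum n (by have := Finset.mem_range.mp he; omega) hn,
        if_pos (by omega)]]
    simp
  have h2 : midCoeff n (X ^ (n - 1) * S) = (n % 2 : ℕ) := by
    rw [hS, midCoeff_X_pow_mul_sum n (by omega) hn]
    split_ifs <;> omega
  have h3 : midCoeff n (X ^ (2 * (n - 1))) = 1 := by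
    rw [midCoeff_X_pow, if_pos rfl]
  set κ : ℕ := n - n % 2 with hκ
  have h4 : (S + (κ : ℤ[X]) * X ^ (n - 1)) ^ 2 =
      S * S + 2 * ((κ : ℤ[X]) * (X ^ (n - 1) * S))
        + (κ : ℤ[X]) * ((κ : ℤ[X]) * X ^ (2 * (n - 1))) := by ring
  rw [h4, map_add, map_add, h1, midCoeff_ofNat_mul, midCoeff_natCast_mul, h2,
    midCoeff_natCast_mul, midCoeff_natCast_mul, h3]
  have h5 : (κ : ℤ) = n - (n % 2 : ℕ) := by omega
  rw [h5]
  rcases Nat.mod_two_eq_zero_or_one n with h | h <;> rw [h] <;> push_cast <;> ring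

/-! ### Coefficients of order two. -/

lemma midCoeff_mirror_mul_X_pow {n i j : ℕ} (hij : i < j) (hj : 2 * j + 1 ≤ n) :
    midCoeff n (mirror n i * mirror n j * X ^ (n - 1)) = 0 := by
  rw [mirror_of_lt (i := i) (by omega)]
  rcases hj.lt_or_eq with h | h
  · rw [mirror_of_lt h]
    simp only [mul_add, add_mul, ← pow_add, map_add, midCoeff_X_pow]
    rw [if_neg (by omega), if_neg (by omega), if_neg (by omega), if_neg (by omega)]
    rfl
  · rw [mirror_center h]
    simp only [add_mul, ← pow_add, map_add, midCoeff_X_pow]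
    rw [if_neg (by omega), if_neg (by omega)]
    rfl

/-- With a = n-1-2i and b = n-1-2j this is the constant term of (z^a + z^{-a})³(z^b + z^{-b}). For
distinct positive a, b only 3a = b contributes, once for each sign. -/
lemma midCoeff_mirror_cube_mul {n i j : ℕ} (hi : 2 * i + 1 < n) (hj : 2 * j + 1 < n)
    (hij : i ≠ j) :
    midCoeff n (mirror n i ^ 3 * mirror n j) =
      if n - 1 - 2 * j = 3 * (n - 1 - 2 * i) then 2 else 0 := by
  have h3 : mirror n i ^ 3 * mirror n j =
      X ^ (3 * i + j) + X ^ (3 * i + (n - 1 - j))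
      + 3 * X ^ (2 * i + (n - 1 - i) + j) + 3 * X ^ (2 * i + (n - 1 - i) + (n - 1 - j))
      + 3 * X ^ (i + 2 * (n - 1 - i) + j) + 3 * X ^ (i + 2 * (n - 1 - i) + (n - 1 - j))
      + X ^ (3 * (n - 1 - i) + j) + X ^ (3 * (n - 1 - i) + (n - 1 - j)) := by
    rw [mirror_of_lt hi, mirror_of_lt hj]
    ring
  rw [h3]
  split_ifs with h <;>
  · simp (disch := omega) only [map_add, midCoeff_ofNat_mul, midCoeff_X_pow_of_eq,
      midCoeff_X_pow_of_ne]
    norm_num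

/-- Pair coefficients for two non-central indices. -/
lemma walshCoeff_mirror_pair {n : ℕ} {i j : Fin ((n + 1) / 2)} (hij : i < j)
    (hj : 2 * (j : ℕ) + 1 < n) :
    walshCoeff (midCoeff n) (fun i : Fin ((n + 1) / 2) => mirror n i) {i, j} =
      24 * (if ((i : ℕ) + j) % 2 = 0 then 1 else 0)
      + 24 * (if (n - 1 + i + j) % 2 = 0 then 1 else 0)
      - 16 * (if n - 1 - 2 * (i : ℕ) = 3 * (n - 1 - 2 * j) then 1 else 0) := by
  have hij' : (i : ℕ) < j := hij
  have hn : 1 < n := by omega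
  rw [walshCoeff_pair _ _ hij.ne, sum_mirror_sq n hn]
  set S : ℤ[X] := ∑ e ∈ Finset.range n, X ^ (2 * e) with hS
  have h0 := midCoeff_mirror_mul_X_pow hij' hj.le
  have h1 : midCoeff n (mirror n i * mirror n j * S) =
      2 * (if ((i : ℕ) + j) % 2 = 0 then 1 else 0)
      + 2 * (if (n - 1 + i + j) % 2 = 0 then 1 else 0) := by
    rw [mirror_of_lt (i := i) (by omega), mirror_of_lt hj]
    simp only [mul_add, add_mul, ← pow_add, map_add, hS]
    rw [midCoeff_X_pow_mul_sum n (by omega) hn, midCoeff_X_pow_mul_sum n (by omega) hn,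
      midCoeff_X_pow_mul_sum n (by omega) hn, midCoeff_X_pow_mul_sum n (by omega) hn]
    split_ifs <;> omega
  have h2 := midCoeff_mirror_cube_mul (n := n) (i := i) (j := j) (by omega) hj hij'.ne
  have h3 := midCoeff_mirror_cube_mul (n := n) (i := j) (j := i) hj (by omega) hij'.ne'
  -- Since i < j, the centred exponent of i is the larger one, so it can only be the tripled one.
  rw [if_neg (by omega)] at h2
  have h4 : mirror n i * mirror n j * (12 * (S + ((n - n % 2 : ℕ) : ℤ[X]) * X ^ (n - 1))
      - 8 * mirror n i ^ 2 - 8 * mirror n j ^ 2) =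
      12 * (mirror n i * mirror n j * S)
      + 12 * (((n - n % 2 : ℕ) : ℤ[X]) * (mirror n i * mirror n j * X ^ (n - 1)))
      - 8 * (mirror n i ^ 3 * mirror n j) - 8 * (mirror n j ^ 3 * mirror n i) := by ring
  rw [h4]
  simp only [map_add, map_sub, midCoeff_ofNat_mul, midCoeff_natCast_mul, h0, h1, h2, h3]
  split_ifs <;> norm_num

/-- Pair coefficients for a central and a non-central index. -/
lemma walshCoeff_mirror_pair_center {n : ℕ} {i j : Fin ((n + 1) / 2)} (hij : i < j)
    (hj : 2 * (j : ℕ) + 1 = n) :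
    walshCoeff (midCoeff n) (fun i : Fin ((n + 1) / 2) => mirror n i) {i, j} =
      24 * (if ((i : ℕ) + j) % 2 = 0 then 1 else 0) := by
  have hij' : (i : ℕ) < j := hij
  have hn : 1 < n := by omega
  rw [walshCoeff_pair _ _ hij.ne, sum_mirror_sq n hn]
  set S : ℤ[X] := ∑ e ∈ Finset.range n, X ^ (2 * e) with hS
  have h0 := midCoeff_mirror_mul_X_pow hij' hj.le
  have h1 : midCoeff n (mirror n i * mirror n j * S) =
      2 * (if ((i : ℕ) + j) % 2 = 0 then 1 else 0) := by
    rw [mirror_of_lt (i := i) (by omega), mirror_center hj]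
    simp only [add_mul, ← pow_add, map_add, hS]
    rw [midCoeff_X_pow_mul_sum n (by omega) hn, midCoeff_X_pow_mul_sum n (by omega) hn]
    split_ifs <;> omega
  have h2 : midCoeff n (mirror n i ^ 3 * mirror n j) = 0 := by
    have h : mirror n i ^ 3 * mirror n j =
        X ^ (3 * (i : ℕ) + j)
        + 3 * X ^ (2 * (i : ℕ) + (n - 1 - i) + j)
        + 3 * X ^ ((i : ℕ) + 2 * (n - 1 - i) + j)
        + X ^ (3 * (n - 1 - i) + j) := by
      rw [mirror_of_lt (i := i) (by omega), mirror_center hj]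
      ring
    rw [h]
    simp only [map_add, midCoeff_ofNat_mul, midCoeff_X_pow]
    split_ifs <;> omega
  have h3 : midCoeff n (mirror n j ^ 3 * mirror n i) = 0 := by
    have h : mirror n j ^ 3 * mirror n i =
        X ^ (3 * (j : ℕ) + i) + X ^ (3 * (j : ℕ) + (n - 1 - i)) := by
      rw [mirror_of_lt (i := i) (by omega), mirror_center hj]
      ring
    rw [h]
    simp only [map_add, midCoeff_X_pow]
    split_ifs <;> omega
  have h4 : mirror n i * mirror n j * (12 * (S + ((n - n % 2 : ℕ) : ℤ[X]) * X ^ (n - 1))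
      - 8 * mirror n i ^ 2 - 8 * mirror n j ^ 2) =
      12 * (mirror n i * mirror n j * S)
      + 12 * (((n - n % 2 : ℕ) : ℤ[X]) * (mirror n i * mirror n j * X ^ (n - 1)))
      - 8 * (mirror n i ^ 3 * mirror n j) - 8 * (mirror n j ^ 3 * mirror n i) := by ring
  rw [h4]
  simp only [map_add, map_sub, midCoeff_ofNat_mul, midCoeff_natCast_mul, h0, h1, h2, h3]
  split_ifs <;> norm_num

/-! ### Coefficients of order four. -/

/-- In centred exponents the coefficient counts the solutions of ±a ± b ± c ± d = 0 with distinct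
positive a, b, c, d. Two solutions that are not negatives of each other would, by addition and
subtraction, make one exponent zero or two of them equal. So there is at most one solution up to
global sign. -/
lemma midCoeff_four_mirror_of_lt {n i j k l : ℕ} (hi : 2 * i + 1 < n) (hj : 2 * j + 1 < n)
    (hk : 2 * k + 1 < n) (hl : 2 * l + 1 < n)
    (hij : i ≠ j) (hik : i ≠ k) (hil : i ≠ l) (hjk : j ≠ k) (hjl : j ≠ l) (hkl : k ≠ l) :
    midCoeff n (mirror n i * mirror n j * mirror n k * mirror n l) = 0 ∨
      midCoeff n (mirror n i * mirror n j * mirror n k * mirror n l) = 2 := by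
  rw [mirror_of_lt hi, mirror_of_lt hj, mirror_of_lt hk, mirror_of_lt hl]
  obtain ⟨i', hi'⟩ : ∃ i', i' = n - 1 - i := ⟨_, rfl⟩
  obtain ⟨j', hj'⟩ : ∃ j', j' = n - 1 - j := ⟨_, rfl⟩
  obtain ⟨k', hk'⟩ : ∃ k', k' = n - 1 - k := ⟨_, rfl⟩
  obtain ⟨l', hl'⟩ : ∃ l', l' = n - 1 - l := ⟨_, rfl⟩
  rw [← hi', ← hj', ← hk', ← hl']
  simp only [mul_add, add_mul, ← pow_add, map_add]
  -- A global sign change is the reflection e ↦ 4(n-1) - e; it leaves eight terms, each occurring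
  -- twice.
  rw [midCoeff_reflect n (a := i' + j + k + l) (b := i + j' + k' + l') (by omega),
    midCoeff_reflect n (a := i' + j' + k + l) (b := i + j + k' + l') (by omega),
    midCoeff_reflect n (a := i' + j + k' + l) (b := i + j' + k + l') (by omega),
    midCoeff_reflect n (a := i' + j' + k' + l) (b := i + j + k + l') (by omega),
    midCoeff_reflect n (a := i' + j + k + l') (b := i + j' + k' + l) (by omega),
    midCoeff_reflect n (a := i' + j' + k + l') (b := i + j + k' + l) (by omega),
    midCoeff_reflect n (a := i' + j + k' + l') (b := i + j' + k + l) (by omega),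
    midCoeff_reflect n (a := i' + j' + k' + l') (b := i + j + k + l) (by omega)]
  by_cases c1 : i + j + k + l' = 2 * (n - 1)
  · right
    simp (disch := omega) only [midCoeff_X_pow_of_eq, midCoeff_X_pow_of_ne]
    norm_num
  by_cases c2 : i + j + k' + l = 2 * (n - 1)
  · right
    simp (disch := omega) only [midCoeff_X_pow_of_eq, midCoeff_X_pow_of_ne]
    norm_num
  by_cases c3 : i + j' + k + l = 2 * (n - 1)
  · right
    simp (disch := omega) only [midCoeff_X_pow_of_eq, midCoeff_X_pow_of_ne]
    norm_num
  by_cases c4 : i + j + k' + l' = 2 * (n - 1)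
  · right
    simp (disch := omega) only [midCoeff_X_pow_of_eq, midCoeff_X_pow_of_ne]
    norm_num
  by_cases c5 : i + j' + k + l' = 2 * (n - 1)
  · right
    simp (disch := omega) only [midCoeff_X_pow_of_eq, midCoeff_X_pow_of_ne]
    norm_num
  by_cases c6 : i + j' + k' + l = 2 * (n - 1)
  · right
    simp (disch := omega) only [midCoeff_X_pow_of_eq, midCoeff_X_pow_of_ne]
    norm_num
  by_cases c7 : i + j' + k' + l' = 2 * (n - 1)
  · right
    simp (disch := omega) only [midCoeff_X_pow_of_eq, midCoeff_X_pow_of_ne]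
    norm_num
  -- The eighth sum, i + j + k + l, is below 2(n-1) because every index lies below the centre.
  left
  simp (disch := omega) only [midCoeff_X_pow_of_ne]
  norm_num

/-- The central factor is a single monomial of centred exponent 0, so the equation becomes ±b ± c ±
d = 0; two essentially different solutions would make one exponent zero. -/
lemma midCoeff_four_mirror_center {n i j k l : ℕ} (hi : 2 * i + 1 = n) (hj : 2 * j + 1 < n)
    (hk : 2 * k + 1 < n) (hl : 2 * l + 1 < n) (hjk : j ≠ k) (hjl : j ≠ l) (hkl : k ≠ l) :
    midCoeff n (mirror n i * mirror n j * mirror n k * mirror n l) = 0 ∨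
      midCoeff n (mirror n i * mirror n j * mirror n k * mirror n l) = 2 := by
  rw [mirror_center hi, mirror_of_lt hj, mirror_of_lt hk, mirror_of_lt hl]
  obtain ⟨j', hj'⟩ : ∃ j', j' = n - 1 - j := ⟨_, rfl⟩
  obtain ⟨k', hk'⟩ : ∃ k', k' = n - 1 - k := ⟨_, rfl⟩
  obtain ⟨l', hl'⟩ : ∃ l', l' = n - 1 - l := ⟨_, rfl⟩
  rw [← hj', ← hk', ← hl']
  replace hj' : j + j' = 2 * i := by omega
  replace hk' : k + k' = 2 * i := by omega
  replace hl' : l + l' = 2 * i := by omega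
  subst hi
  simp only [mul_add, add_mul, ← pow_add, map_add]
  rw [midCoeff_reflect _ (a := i + j' + k + l) (b := i + j + k' + l') (by omega),
    midCoeff_reflect _ (a := i + j' + k' + l) (b := i + j + k + l') (by omega),
    midCoeff_reflect _ (a := i + j' + k + l') (b := i + j + k' + l) (by omega),
    midCoeff_reflect _ (a := i + j' + k' + l') (b := i + j + k + l) (by omega)]
  by_cases c1 : i + j + k + l' = 2 * (2 * i + 1 - 1)
  · right
    simp (disch := omega) only [midCoeff_X_pow_of_eq, midCoeff_X_pow_of_ne]
    norm_num
  by_cases c2 : i + j + k' + l = 2 * (2 * i + 1 - 1)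
  · right
    simp (disch := omega) only [midCoeff_X_pow_of_eq, midCoeff_X_pow_of_ne]
    norm_num
  by_cases c3 : i + j + k' + l' = 2 * (2 * i + 1 - 1)
  · right
    simp (disch := omega) only [midCoeff_X_pow_of_eq, midCoeff_X_pow_of_ne]
    norm_num
  left
  simp (disch := omega) only [midCoeff_X_pow_of_ne]
  norm_num

lemma midCoeff_four_mirror {n i j k l : ℕ} (hi : 2 * i + 1 ≤ n) (hj : 2 * j + 1 ≤ n)
    (hk : 2 * k + 1 ≤ n) (hl : 2 * l + 1 ≤ n)
    (hij : i ≠ j) (hik : i ≠ k) (hil : i ≠ l) (hjk : j ≠ k) (hjl : j ≠ l) (hkl : k ≠ l) :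
    midCoeff n (mirror n i * mirror n j * mirror n k * mirror n l) = 0 ∨
      midCoeff n (mirror n i * mirror n j * mirror n k * mirror n l) = 2 := by
  by_cases ci : 2 * i + 1 = n
  · exact midCoeff_four_mirror_center ci (by omega) (by omega) (by omega) hjk hjl hkl
  by_cases cj : 2 * j + 1 = n
  · rw [mul_comm (mirror n i)]
    exact midCoeff_four_mirror_center cj (by omega) (by omega) (by omega) hik hil hkl
  by_cases ck : 2 * k + 1 = n
  · rw [mul_right_comm (mirror n i), mul_comm (mirror n i)]
    exact midCoeff_four_mirror_center ck (by omega) (by omega) (by omega) hij hil hjl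
  by_cases cl : 2 * l + 1 = n
  · rw [mul_right_comm _ (mirror n k), mul_right_comm (mirror n i), mul_comm (mirror n i)]
    exact midCoeff_four_mirror_center cl (by omega) (by omega) (by omega) hij hik hjk
  exact midCoeff_four_mirror_of_lt (by omega) (by omega) (by omega) (by omega)
    hij hik hil hjk hjl hkl

lemma walshCoeff_mirror_four (n : ℕ) {T : Finset (Fin ((n + 1) / 2))} (hT : T.card = 4) :
    walshCoeff (midCoeff n) (fun i : Fin ((n + 1) / 2) => mirror n i) T = 0 ∨
      walshCoeff (midCoeff n) (fun i : Fin ((n + 1) / 2) => mirror n i) T = 48 := by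
  obtain ⟨i, T', hi, rfl, hT'⟩ := Finset.card_eq_succ.mp hT
  obtain ⟨j, k, l, hjk, hjl, hkl, rfl⟩ := Finset.card_eq_three.mp hT'
  simp only [Finset.mem_insert, Finset.mem_singleton, not_or] at hi
  obtain ⟨hij, hik, hil⟩ := hi
  rw [walshCoeff_four _ _ hij hik hil hjk hjl hkl, midCoeff_ofNat_mul]
  rcases midCoeff_four_mirror (n := n) (i := i) (j := j) (k := k) (l := l)
    (by omega) (by omega) (by omega) (by omega) (Fin.val_ne_of_ne hij) (Fin.val_ne_of_ne hik)
    (Fin.val_ne_of_ne hil) (Fin.val_ne_of_ne hjk) (Fin.val_ne_of_ne hjl)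
    (Fin.val_ne_of_ne hkl) with h | h
  · left; rw [h]; norm_num
  · right; rw [h]; norm_num

end MirrorPolynomials

/-! ### The value at the all-ones signs, and counting pairs. -/

section Moments

lemma coeff_geom_sum (n k : ℕ) :
    (∑ e ∈ Finset.range n, (X : ℤ[X]) ^ e).coeff k = if k < n then 1 else 0 := by
  simp [finsetSum_coeff, coeff_X_pow]

lemma coeff_geom_sum_sq (n k : ℕ) :
    ((∑ e ∈ Finset.range n, (X : ℤ[X]) ^ e) ^ 2).coeff k =
      ((min n (k + 1) - (k + 1 - n) : ℕ) : ℤ) := by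
  rw [sq, coeff_mul, Finset.Nat.sum_antidiagonal_eq_sum_range_succ_mk]
  simp only [coeff_geom_sum, ← ite_and, mul_ite, mul_one, mul_zero]
  rw [← Finset.sum_filter]
  have : (Finset.range k.succ).filter (fun x => k - x < n ∧ x < n) =
      Finset.Ico (k + 1 - n) (min n (k + 1)) := by
    ext x
    simp only [Finset.mem_filter, Finset.mem_range, Finset.mem_Ico]
    omega
  rw [this]
  simp

lemma six_mul_sum_sq (m : ℕ) :
    6 * ∑ x ∈ Finset.range m, ((x : ℤ) + 1) ^ 2 =
      (m : ℤ) * (m + 1) * (2 * m + 1) := by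
  induction m with
  | zero => simp
  | succ k ih =>
    rw [Finset.sum_range_succ, mul_add, ih]
    push_cast
    ring

/-- The square of the geometric sum has coefficients 1, 2, ..., n, ..., 2, 1; by symmetry the
central coefficient of the fourth power is the sum of their squares. -/
lemma three_mul_midCoeff_geom_sum_pow_four (n : ℕ) (hn : 1 < n) :
    3 * midCoeff n ((∑ e ∈ Finset.range n, X ^ e) ^ 4) = n * (2 * (n : ℤ) ^ 2 + 1) := by
  obtain ⟨m, rfl⟩ : ∃ m, n = m + 1 := ⟨n - 1, by omega⟩
  rw [midCoeff_apply, show 4 = 2 + 2 from rfl, pow_add, coeff_mul,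
    Finset.Nat.sum_antidiagonal_eq_sum_range_succ_mk, Nat.add_sub_cancel]
  simp only [coeff_geom_sum_sq]
  rw [sum_range_fold_odd]
  have h1 : ∀ x ∈ Finset.range m,
      ((min (m + 1) (x + 1) - (x + 1 - (m + 1)) : ℕ) : ℤ) *
          ((min (m + 1) (2 * m - x + 1) - (2 * m - x + 1 - (m + 1)) : ℕ) : ℤ) +
        ((min (m + 1) (2 * m - x + 1) - (2 * m - x + 1 - (m + 1)) : ℕ) : ℤ) *
          ((min (m + 1) (2 * m - (2 * m - x) + 1) - (2 * m - (2 * m - x) + 1 - (m + 1)) : ℕ) : ℤ)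
      = 2 * ((x : ℤ) + 1) ^ 2 := by
    intro x hx
    have := Finset.mem_range.mp hx
    rw [show min (m + 1) (x + 1) - (x + 1 - (m + 1)) = x + 1 by omega,
      show min (m + 1) (2 * m - x + 1) - (2 * m - x + 1 - (m + 1)) = x + 1 by omega,
      show min (m + 1) (2 * m - (2 * m - x) + 1) - (2 * m - (2 * m - x) + 1 - (m + 1)) = x + 1
        by omega]
    push_cast
    ring
  rw [Finset.sum_congr rfl h1, ← Finset.mul_sum,
    show min (m + 1) (m + 1) - (m + 1 - (m + 1)) = m + 1 by omega,
    show min (m + 1) (2 * m - m + 1) - (2 * m - m + 1 - (m + 1)) = m + 1 by omega]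
  have := six_mul_sum_sq m
  push_cast
  linear_combination this

/-- Every two-element set has a unique increasing listing. -/
lemma sum_powersetCard_two {M : Type*} [AddCommMonoid M] {h : ℕ} (F : Finset (Fin h) → M)
    (f : ℕ → ℕ → M) (hf : ∀ i j : Fin h, i < j → F {i, j} = f i j) :
    ∑ T ∈ Finset.powersetCard 2 Finset.univ, F T =
      ∑ j ∈ Finset.range h, ∑ i ∈ Finset.range j, f i j := by
  have h1 : ∑ x ∈ (Finset.univ : Finset (Fin h × Fin h)).filter (fun x => x.1 < x.2),
      f x.1 x.2 = ∑ T ∈ Finset.powersetCard 2 Finset.univ, F T := by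
    refine Finset.sum_bij (fun x _ => {x.1, x.2}) ?_ ?_ ?_ ?_
    · intro x hx
      simp only [Finset.mem_filter, Finset.mem_univ, true_and] at hx
      simp [Finset.mem_powersetCard, Finset.card_pair hx.ne]
    · rintro ⟨a, b⟩ hx ⟨c, d⟩ hy hxy
      simp only [Finset.mem_filter, Finset.mem_univ, true_and] at hx hy hxy
      have ha : a ∈ ({c, d} : Finset (Fin h)) := hxy ▸ by simp
      have hb : b ∈ ({c, d} : Finset (Fin h)) := hxy ▸ by simp
      simp only [Finset.mem_insert, Finset.mem_singleton] at ha hb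
      rw [Prod.mk.injEq]
      omega
    · intro T hT
      obtain ⟨a, b, hab, rfl⟩ := Finset.card_eq_two.mp (Finset.mem_powersetCard.mp hT).2
      rcases hab.lt_or_gt with hlt | hlt
      · exact ⟨(a, b), by simpa using hlt, rfl⟩
      · exact ⟨(b, a), by simpa using hlt, Finset.pair_comm _ _⟩
    · intro x hx
      exact (hf _ _ (by simpa using hx)).symm
  rw [← h1, Finset.sum_filter, ← Finset.univ_product_univ, Finset.sum_product_right]
  simp only [Fin.lt_def]
  rw [Fin.sum_univ_eq_sum_range (fun j => ∑ i : Fin h, if (i : ℕ) < j then f i j else 0)]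
  refine Finset.sum_congr rfl fun j hj => ?_
  rw [Fin.sum_univ_eq_sum_range (fun i => if i < j then f i j else 0), ← Finset.sum_filter]
  refine Finset.sum_congr ?_ fun _ _ => rfl
  have := Finset.mem_range.mp hj
  ext i
  simp only [Finset.mem_filter, Finset.mem_range]
  omega

lemma sum_ratio_three {n j : ℕ} (hj : 2 * j + 1 < n) :
    ∑ i ∈ Finset.range j, (if n - 1 - 2 * i = 3 * (n - 1 - 2 * j) then (1 : ℤ) else 0) =
      if n - 1 ≤ 3 * j then 1 else 0 := by
  split_ifs with h
  -- Solving the ratio equation for i gives i = 3j - (n-1), which is a natural number exactly when n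
  -- - 1 ≤ 3j.
  · rw [Finset.sum_eq_single (3 * j - (n - 1))]
    · rw [if_pos (by omega)]
    · intro i hi hne
      have := Finset.mem_range.mp hi
      rw [if_neg (by omega)]
    · intro hi
      exact absurd (Finset.mem_range.mpr (by omega)) hi
  · refine Finset.sum_eq_zero fun i hi => if_neg ?_
    have := Finset.mem_range.mp hi
    omega

lemma sum_le_three_mul (m h : ℕ) :
    ∑ j ∈ Finset.range h, (if m ≤ 3 * j then (1 : ℤ) else 0) = (h - (m + 2) / 3 : ℕ) := by
  rw [← Finset.sum_filter]
  have : (Finset.range h).filter (fun j => m ≤ 3 * j) = Finset.Ico ((m + 2) / 3) h := by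
    ext x
    simp only [Finset.mem_filter, Finset.mem_range, Finset.mem_Ico]
    omega
  rw [this]
  simp

lemma sum_even_add (m : ℕ) :
    ∑ i ∈ Finset.range m, (if (i + m) % 2 = 0 then (1 : ℤ) else 0) = (m / 2 : ℕ) := by
  have h : ∀ k, ∑ i ∈ Finset.range k, (if i % 2 = 1 then (1 : ℤ) else 0) = (k / 2 : ℕ) := by
    intro k
    induction k with
    | zero => simp
    | succ k ih =>
      rw [Finset.sum_range_succ, ih]
      split_ifs <;> omega
  rw [← h m, ← Finset.sum_range_reflect]
  refine Finset.sum_congr rfl fun i hi => ?_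
  have := Finset.mem_range.mp hi
  exact if_congr (by omega) rfl rfl

/-! ### First and second moments over the sign cube. -/

/-- The quartic form `ε ↦ ‖f_ε‖₄⁴` in the free signs of a reciprocal Littlewood polynomial. -/
noncomputable def quartic (n : ℕ) (ε : Fin ((n + 1) / 2) → ℤˣ) : ℤ :=
  midCoeff n (signSum (fun i : Fin ((n + 1) / 2) => mirror n i) ε ^ 4)

lemma sum_quartic (n : ℕ) (hn : 1 < n) :
    ∑ ε, quartic n ε = 2 ^ ((n + 1) / 2) * (3 * (n : ℤ) ^ 2 - 3 * n + (n % 2 : ℕ)) := by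
  have := sum_walsh_mul_quartic (midCoeff n) (fun i : Fin ((n + 1) / 2) => mirror n i) ∅
  rw [walshCoeff_mirror_empty n hn] at this
  simpa [walsh, quartic] using this

lemma sum_quartic_sq_eq (n : ℕ) (hn : 1 < n) :
    ∑ ε, quartic n ε ^ 2 = 2 ^ ((n + 1) / 2) * ((3 * (n : ℤ) ^ 2 - 3 * n + (n % 2 : ℕ)) ^ 2
      + ∑ T ∈ Finset.powersetCard 2 Finset.univ,
          walshCoeff (midCoeff n) (fun i : Fin ((n + 1) / 2) => mirror n i) T *
          (walshCoeff (midCoeff n) (fun i : Fin ((n + 1) / 2) => mirror n i) T - 48)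
      + 16 * (n * (2 * (n : ℤ) ^ 2 + 1)) - 48 * (3 * (n : ℤ) ^ 2 - 3 * n + (n % 2 : ℕ))) := by
  have h := sum_quartic_sq (midCoeff n) (fun i : Fin ((n + 1) / 2) => mirror n i)
  rw [sum_sq_walshCoeff _ _ 48 (fun T hT => walshCoeff_mirror_four n hT),
    walshCoeff_mirror_empty n hn, sum_mirror n hn, Fintype.card_fin] at h
  have h3 := three_mul_midCoeff_geom_sum_pow_four n hn
  unfold quartic
  rw [h]
  linear_combination (2 ^ ((n + 1) / 2) * 16) * h3

lemma sum_pairs_even (h : ℕ) (hh : 0 < h) :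
    ∑ T ∈ Finset.powersetCard 2 Finset.univ,
      walshCoeff (midCoeff (2 * h)) (fun i : Fin ((2 * h + 1) / 2) => mirror (2 * h) i) T *
      (walshCoeff (midCoeff (2 * h)) (fun i : Fin ((2 * h + 1) / 2) => mirror (2 * h) i) T - 48) =
    -288 * (h * (h - 1)) + 256 * (h - (2 * h + 1) / 3 : ℕ) := by
  -- For even n exactly one of the two parity conditions holds, so c is 24, or 24 - 16 = 8 at ratio
  -- 3. Then c(c - 48) is -576 or -320 = -576 + 256.
  rw [sum_powersetCard_two _ (fun i j => -576 + 256 *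
    (if 2 * h - 1 - 2 * i = 3 * (2 * h - 1 - 2 * j) then (1 : ℤ) else 0))]
  · rw [show (2 * h + 1) / 2 = h by omega]
    have h1 : ∀ j ∈ Finset.range h, ∑ i ∈ Finset.range j, (-576 + 256 *
        (if 2 * h - 1 - 2 * i = 3 * (2 * h - 1 - 2 * j) then (1 : ℤ) else 0)) =
        -576 * (j : ℤ) + 256 * (if 2 * h - 1 ≤ 3 * j then 1 else 0) := by
      intro j hj
      have := Finset.mem_range.mp hj
      rw [Finset.sum_add_distrib, ← Finset.mul_sum, sum_ratio_three (by omega)]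
      simp [mul_comm]
    rw [Finset.sum_congr rfl h1, Finset.sum_add_distrib, ← Finset.mul_sum, ← Finset.mul_sum,
      sum_le_three_mul, show 2 * h - 1 + 2 = 2 * h + 1 by omega]
    have h2 : (2 : ℤ) * ∑ j ∈ Finset.range h, (j : ℤ) = h * (h - 1) := by
      have := Finset.sum_range_id_mul_two h
      zify [hh] at this
      rw [← this, mul_comm]
    linear_combination (-288) * h2
  · intro i j hij
    rw [walshCoeff_mirror_pair hij (by omega)]
    split_ifs <;> first | (exfalso; omega) | norm_num

lemma sum_pairs_odd (m : ℕ) :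
    ∑ T ∈ Finset.powersetCard 2 Finset.univ,
      walshCoeff (midCoeff (2 * m + 1))
        (fun i : Fin ((2 * m + 1 + 1) / 2) => mirror (2 * m + 1) i) T *
      (walshCoeff (midCoeff (2 * m + 1))
        (fun i : Fin ((2 * m + 1 + 1) / 2) => mirror (2 * m + 1) i) T - 48) =
    -512 * (m / 3 : ℕ) - 576 * (m / 2 : ℕ) := by
  -- Off the centre the two parity conditions coincide, so c is 0 or 48 and contributes nothing,
  -- except at ratio 3, which forces equal parity: there c = 32 and c(c - 48) = -512. Against the
  -- centre c is 0 or 24, contributing 0 or -576.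
  rw [sum_powersetCard_two _ (fun i j => if j = m
    then -576 * (if (i + m) % 2 = 0 then (1 : ℤ) else 0)
    else -512 * (if 2 * m + 1 - 1 - 2 * i = 3 * (2 * m + 1 - 1 - 2 * j) then (1 : ℤ) else 0))]
  · rw [show (2 * m + 1 + 1) / 2 = m + 1 by omega, Finset.sum_range_succ]
    have h1 : ∀ j ∈ Finset.range m, ∑ i ∈ Finset.range j, (if j = m
        then -576 * (if (i + m) % 2 = 0 then (1 : ℤ) else 0)
        else -512 * (if 2 * m + 1 - 1 - 2 * i = 3 * (2 * m + 1 - 1 - 2 * j)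
          then (1 : ℤ) else 0)) =
        -512 * (if 2 * m + 1 - 1 ≤ 3 * j then 1 else 0) := by
      intro j hj
      have := Finset.mem_range.mp hj
      simp only [if_neg this.ne]
      rw [← Finset.mul_sum, sum_ratio_three (by omega)]
    rw [Finset.sum_congr rfl h1, ← Finset.mul_sum, sum_le_three_mul]
    simp only [if_true]
    rw [← Finset.mul_sum, sum_even_add]
    omega
  · intro i j hij
    have hij' : (i : ℕ) < j := hij
    by_cases hj : (j : ℕ) = m
    · rw [walshCoeff_mirror_pair_center hij (by omega), if_pos hj, hj]
      split_ifs <;> norm_num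
    · rw [walshCoeff_mirror_pair hij (by omega), if_neg hj]
      split_ifs <;> first | (exfalso; omega) | norm_num

lemma sum_quartic_sq_even (n : ℕ) (hn : 1 < n) (he : Even n) :
    ∑ ε, quartic n ε ^ 2 = 2 ^ ((n + 1) / 2) * ((3 * (n : ℤ) ^ 2 - 3 * n + (n % 2 : ℕ)) ^ 2
      + (32 * (n : ℤ) ^ 3 - 216 * (n : ℤ) ^ 2 + 304 * n + 256 * ((n / 6 : ℕ) : ℤ)
        + 256 * (if n % 6 = 4 then 1 else 0))) := by
  rw [sum_quartic_sq_eq n hn]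
  obtain ⟨h, rfl⟩ := he.exists_two_nsmul
  simp only [smul_eq_mul] at *
  rw [sum_pairs_even h (by omega), show 2 * h % 2 = 0 by omega]
  have h6 : ((h - (2 * h + 1) / 3 : ℕ) : ℤ) =
      ((2 * h / 6 : ℕ) : ℤ) + (if 2 * h % 6 = 4 then 1 else 0) := by
    split_ifs <;> omega
  rw [h6]
  push_cast
  ring

lemma sum_quartic_sq_odd (n : ℕ) (hn : 1 < n) (ho : Odd n) :
    ∑ ε, quartic n ε ^ 2 = 2 ^ ((n + 1) / 2) * ((3 * (n : ℤ) ^ 2 - 3 * n + (n % 2 : ℕ)) ^ 2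
      + (32 * (n : ℤ) ^ 3 - 144 * (n : ℤ) ^ 2 + 160 * n - 576 * (((n - 1) / 4 : ℕ) : ℤ)
        - 512 * (((n - 1) / 6 : ℕ) : ℤ) - 48)) := by
  rw [sum_quartic_sq_eq n hn]
  obtain ⟨m, rfl⟩ := ho
  rw [sum_pairs_odd m, show (2 * m + 1) % 2 = 1 by omega,
    show (2 * m + 1 - 1) / 4 = m / 2 by omega, show (2 * m + 1 - 1) / 6 = m / 3 by omega]
  push_cast
  ring

end Moments

/-! ### From the `L⁴` norm to the quartic form, and parametrization by signs. -/

section Reciprocal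

/-- Parseval for f², since |f|⁴ = |f²|². -/
lemma lpNorm_four_pow (f : ℂ[X]) :
    lpNorm 4 f ^ 4 = ∑ i ∈ (f ^ 2).support, ‖(f ^ 2).coeff i‖ ^ 2 := by
  rw [sum_sq_norm_coeff_eq_circleAverage, lpNorm, Real.circleAverage_def, smul_eq_mul, one_div,
    ← Real.rpow_natCast, ← Real.rpow_mul]
  · norm_num
    refine intervalIntegral.integral_congr fun θ _ => ?_
    simp only [circleMap, zero_add, Complex.ofReal_one, one_mul]
    rw [mul_comm (θ : ℂ)]
    ring
  -- The real exponents 1/4 and 4 are merged for a nonnegative base.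
  · refine mul_nonneg (by positivity) ?_
    exact intervalIntegral.integral_nonneg (by positivity) fun θ _ => by positivity

lemma comp_neg_X_coeff (f : ℂ[X]) (k : ℕ) :
    (f.comp (-X)).coeff k = f.coeff k * (-1) ^ k := by
  rw [← comp_C_mul_X_coeff]
  simp

lemma lpNorm_four_pow_comp_neg_X (f : ℂ[X]) :
    lpNorm 4 (f.comp (-X)) ^ 4 = lpNorm 4 f ^ 4 := by
  have h : ∀ k, ‖((f.comp (-X)) ^ 2).coeff k‖ = ‖(f ^ 2).coeff k‖ := by
    intro k
    rw [← pow_comp, comp_neg_X_coeff]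
    simp
  rw [lpNorm_four_pow, lpNorm_four_pow]
  refine Finset.sum_congr ?_ fun k _ => by rw [h]
  ext k
  rw [mem_support_iff, mem_support_iff, ← norm_ne_zero_iff, h, norm_ne_zero_iff]

/-- For a palindromic integer polynomial the fourth power of the `L⁴` norm is the central
coefficient of the fourth power. -/
lemma lpNorm_four_pow_of_reflect (n : ℕ) (g : ℤ[X]) (hdeg : g.natDegree ≤ n - 1)
    (hg : reflect (n - 1) g = g) :
    lpNorm 4 (g.map (Int.castRingHom ℂ)) ^ 4 = (midCoeff n (g ^ 4) : ℤ) := by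
  have hd : (g ^ 2).natDegree ≤ 2 * (n - 1) := natDegree_pow_le_of_le 2 hdeg
  have hr : ∀ k ≤ 2 * (n - 1), (g ^ 2).coeff (2 * (n - 1) - k) = (g ^ 2).coeff k := by
    intro k hk
    have : reflect (2 * (n - 1)) (g ^ 2) = g ^ 2 := by
      rw [two_mul, sq, reflect_mul g g hdeg hdeg, hg]
    nth_rw 2 [← this]
    rw [coeff_reflect, revAt_le hk]
  rw [lpNorm_four_pow, midCoeff_apply, show 4 = 2 + 2 from rfl, pow_add, coeff_mul,
    Finset.Nat.sum_antidiagonal_eq_sum_range_succ_mk, ← Polynomial.map_pow]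
  rw [Finset.sum_subset (s₂ := Finset.range (2 * (n - 1)).succ)]
  · push_cast
    refine Finset.sum_congr rfl fun k hk => ?_
    have := Finset.mem_range.mp hk
    rw [hr k (by omega), coeff_map]
    simp [sq]
  · intro k hk
    rw [mem_support_iff, coeff_map] at hk
    have : (g ^ 2).coeff k ≠ 0 := fun h => hk (by rw [h, map_zero])
    have := le_natDegree_of_ne_zero this
    exact Finset.mem_range.mpr (by omega)
  · intro k _ hk
    rw [notMem_support_iff.mp hk]
    simp

lemma coeff_mirror {n i : ℕ} (hi : 2 * i + 1 ≤ n) (k : ℕ) :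
    (mirror n i).coeff k = if k = i ∨ k = n - 1 - i then 1 else 0 := by
  rcases hi.lt_or_eq with h | h
  · rw [mirror_of_lt h, coeff_add, coeff_X_pow, coeff_X_pow]
    split_ifs <;> omega
  · rw [mirror_center h, coeff_X_pow]
    exact if_congr (by omega) rfl rfl

lemma coeff_signSum_mirror {n : ℕ} (ε : Fin ((n + 1) / 2) → ℤˣ) (k : ℕ) :
    (signSum (fun i : Fin ((n + 1) / 2) => mirror n i) ε).coeff k =
      if h : k < n then (ε ⟨min k (n - 1 - k), by omega⟩ : ℤ) else 0 := by
  have h1 : ∀ i : Fin ((n + 1) / 2), (((ε i : ℤ) : ℤ[X]) * mirror n i).coeff k =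
      if k = i ∨ k = n - 1 - i then (ε i : ℤ) else 0 := by
    intro i
    rw [← zsmul_eq_mul, coeff_smul, coeff_mirror (by omega)]
    simp
  rw [signSum, finsetSum_coeff, Finset.sum_congr rfl fun i _ => h1 i]
  split_ifs with h
  · rw [Finset.sum_eq_single ⟨min k (n - 1 - k), by omega⟩]
    · rw [if_pos]
      simp only
      omega
    · intro i _ hi
      refine if_neg fun hk => hi (Fin.ext ?_)
      simp only
      omega
    · simp
  · exact Finset.sum_eq_zero fun i _ => if_neg (by omega)

lemma natDegree_signSum_mirror_le {n : ℕ} (ε : Fin ((n + 1) / 2) → ℤˣ) :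
    (signSum (fun i : Fin ((n + 1) / 2) => mirror n i) ε).natDegree ≤ n - 1 := by
  rw [natDegree_le_iff_coeff_eq_zero]
  intro k hk
  rw [coeff_signSum_mirror, dif_neg (by omega)]

lemma reflect_signSum_mirror {n : ℕ} (ε : Fin ((n + 1) / 2) → ℤˣ) :
    reflect (n - 1) (signSum (fun i : Fin ((n + 1) / 2) => mirror n i) ε) =
      signSum (fun i : Fin ((n + 1) / 2) => mirror n i) ε := by
  ext k
  rw [coeff_reflect]
  by_cases hk : k ≤ n - 1
  · rw [revAt_le hk, coeff_signSum_mirror, coeff_signSum_mirror]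
    by_cases hn : k < n
    · rw [dif_pos (by omega), dif_pos hn]
      congr 3
      omega
    · rw [dif_neg (by omega), dif_neg hn]
  · rw [revAt_eq_self_of_lt (by omega)]

/-- The reciprocal Littlewood polynomial with first half of coefficients `ε`. -/
noncomputable def recPoly (n : ℕ) (ε : Fin ((n + 1) / 2) → ℤˣ) : ℂ[X] :=
  (signSum (fun i : Fin ((n + 1) / 2) => mirror n i) ε).map (Int.castRingHom ℂ)

lemma lpNorm_recPoly (n : ℕ) (ε : Fin ((n + 1) / 2) → ℤˣ) :
    lpNorm 4 (recPoly n ε) ^ 4 = (quartic n ε : ℤ) :=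
  lpNorm_four_pow_of_reflect n _ (natDegree_signSum_mirror_le ε) (reflect_signSum_mirror ε)

lemma coeff_recPoly {n : ℕ} (ε : Fin ((n + 1) / 2) → ℤˣ) (k : ℕ) :
    (recPoly n ε).coeff k =
      if h : k < n then (((ε ⟨min k (n - 1 - k), by omega⟩ : ℤˣ) : ℤ) : ℂ) else 0 := by
  rw [recPoly, coeff_map, coeff_signSum_mirror]
  split_ifs <;> simp

lemma recPoly_injective (n : ℕ) : Function.Injective (recPoly n) := by
  intro ε δ h
  funext i
  have := congrArg (fun f => f.coeff (i : ℕ)) h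
  simp only [coeff_recPoly] at this
  rw [dif_pos (by omega), dif_pos (by omega)] at this
  have hi : (⟨min (i : ℕ) (n - 1 - i), by omega⟩ : Fin ((n + 1) / 2)) = i :=
    Fin.ext (by simp only; omega)
  rw [hi] at this
  exact Units.ext (by exact_mod_cast this)

lemma eval_reflect_eq (f : ℂ[X]) {N : ℕ} (hf : f.natDegree ≤ N) {z : ℂ} (hz : z ≠ 0) :
    (reflect N f).eval z = z ^ N * f.eval z⁻¹ := by
  let _ := invertibleOfNonzero (inv_ne_zero hz)
  have := eval₂_reflect_mul_pow (RingHom.id ℂ) z⁻¹ N f hf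
  rw [invOf_eq_inv, inv_inv] at this
  rw [eval, eval, ← this, mul_comm, mul_assoc, ← mul_pow, inv_mul_cancel₀ hz, one_pow, mul_one]

/-- The functional equation holds at infinitely many points, hence is a polynomial identity about
reversed coefficients. -/
lemma mem_reciprocal_iff {n : ℕ} {f : ℂ[X]} :
    f ∈ reciprocal n ↔ f ∈ littlewood n ∧ reflect (n - 1) f = f := by
  refine and_congr_right fun hf => ?_
  have hd : f.natDegree ≤ n - 1 := by have := hf.1; omega
  constructor
  · intro h
    refine eq_of_infinite_eval_eq _ _ ((Set.finite_singleton (0 : ℂ)).infinite_compl.mono ?_)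
    intro z hz
    have hz : z ≠ 0 := hz
    simp only [Set.mem_ofPred_eq]
    rw [eval_reflect_eq f hd hz, h z hz]
  · intro h z hz
    rw [← eval_reflect_eq f hd hz, h]

lemma recPoly_mem (n : ℕ) (hn : 1 < n) (ε : Fin ((n + 1) / 2) → ℤˣ) :
    recPoly n ε ∈ reciprocal n := by
  refine mem_reciprocal_iff.mpr ⟨⟨?_, fun k hk => ?_⟩, ?_⟩
  · have h1 : (recPoly n ε).natDegree ≤ n - 1 :=
      natDegree_map_le.trans (natDegree_signSum_mirror_le ε)
    have h2 : n - 1 ≤ (recPoly n ε).natDegree := by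
      refine le_natDegree_of_ne_zero ?_
      rw [coeff_recPoly, dif_pos (by omega)]
      exact_mod_cast Units.ne_zero _
    omega
  · rw [coeff_recPoly, dif_pos hk]
    rcases Int.units_eq_one_or (ε ⟨min k (n - 1 - k), by omega⟩) with h | h <;> rw [h] <;> simp
  · rw [recPoly, reflect_map, reflect_signSum_mirror]

lemma range_recPoly (n : ℕ) (hn : 1 < n) : Set.range (recPoly n) = reciprocal n := by
  refine Set.Subset.antisymm (Set.range_subset_iff.mpr (recPoly_mem n hn)) fun f hf => ?_
  obtain ⟨⟨hd, hc⟩, hr⟩ := mem_reciprocal_iff.mp hf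
  refine ⟨fun i => if f.coeff i = 1 then 1 else -1, ?_⟩
  ext k
  rw [coeff_recPoly]
  by_cases hk : k < n
  · rw [dif_pos hk]
    have hs : f.coeff (min k (n - 1 - k)) = f.coeff k := by
      rcases min_choice k (n - 1 - k) with h | h <;> rw [h]
      nth_rw 2 [← hr]
      rw [coeff_reflect, revAt_le (by omega)]
    simp only [hs]
    rcases hc k hk with h | h <;> rw [h] <;> norm_num
  · rw [dif_neg hk]
    exact (coeff_eq_zero_of_natDegree_lt (by omega)).symm

lemma comp_neg_X_mem_littlewood {n : ℕ} {f : ℂ[X]} (hf : f ∈ littlewood n) :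
    f.comp (-X) ∈ littlewood n := by
  refine ⟨?_, fun k hk => ?_⟩
  · rw [natDegree_comp]
    simpa using hf.1
  · rw [comp_neg_X_coeff]
    rcases hf.2 k hk with h | h <;> rcases neg_one_pow_eq_or ℂ k with h' | h' <;> simp [h, h']

/-- Since n - 1 is odd, replacing z by -z introduces the sign that exchanges the two symmetry types.
-/
lemma comp_neg_X_mem_negReciprocal {n : ℕ} (hn : 1 < n) (he : Even n) {f : ℂ[X]}
    (hf : f ∈ reciprocal n) : f.comp (-X) ∈ negReciprocal n := by
  refine ⟨comp_neg_X_mem_littlewood hf.1, he, fun z hz => ?_⟩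
  have ho : Odd (n - 1) := Nat.Even.sub_odd hn.le he odd_one
  simp only [eval_comp, eval_neg, eval_X]
  rw [hf.2 (-z) (neg_ne_zero.mpr hz), ho.neg_pow, inv_neg]
  ring

lemma comp_neg_X_mem_reciprocal {n : ℕ} (hn : 1 < n) {f : ℂ[X]}
    (hf : f ∈ negReciprocal n) : f.comp (-X) ∈ reciprocal n := by
  refine ⟨comp_neg_X_mem_littlewood hf.1, fun z hz => ?_⟩
  have ho : Odd (n - 1) := Nat.Even.sub_odd hn.le hf.2.1 odd_one
  simp only [eval_comp, eval_neg, eval_X]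
  rw [hf.2.2 (-z) (neg_ne_zero.mpr hz), ho.neg_pow, inv_neg]
  ring

lemma range_recPoly_comp_neg_X (n : ℕ) (hn : 1 < n) (he : Even n) :
    Set.range (fun ε => (recPoly n ε).comp (-X)) = negReciprocal n := by
  refine Set.Subset.antisymm (Set.range_subset_iff.mpr fun ε =>
    comp_neg_X_mem_negReciprocal hn he (recPoly_mem n hn ε)) fun f hf => ?_
  have := comp_neg_X_mem_reciprocal hn hf
  rw [← range_recPoly n hn] at this
  obtain ⟨ε, hε⟩ := this
  exact ⟨ε, by simp only; rw [hε, comp_neg_X_comp_neg_X]⟩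

lemma recPoly_comp_neg_X_injective (n : ℕ) :
    Function.Injective (fun ε => (recPoly n ε).comp (-X)) := by
  intro ε δ h
  refine recPoly_injective n ?_
  rw [← comp_neg_X_comp_neg_X (recPoly n ε), ← comp_neg_X_comp_neg_X (recPoly n δ)]
  exact congrArg (fun f => f.comp (-X)) h

end Reciprocal

/-! ### Expectations under a uniform law as averages over the parametrization. -/

section UniformLaw

variable {Ω 𝓧 α : Type*} [MeasurableSpace Ω] [MeasurableSpace 𝓧] [DiscreteMeasurableSpace 𝓧]
  [Fintype α] {P : Measure Ω} {e : α → 𝓧} {f : Ω → 𝓧}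

omit [Fintype α] in
lemma ae_mem_of_hasLaw_uniformOn (hf : HasLaw f (uniformOn (Set.range e)) P) :
    ∀ᵐ ω ∂P, f ω ∈ Set.range e :=
  (hf.ae_iff (p := fun x => x ∈ Set.range e) Measurable.of_discrete).mpr
    (ae_cond_mem (MeasurableSet.of_discrete))

lemma integral_of_hasLaw_uniformOn (he : Function.Injective e)
    (hf : HasLaw f (uniformOn (Set.range e)) P) (Y : 𝓧 → ℝ) :
    ∫ ω, Y (f ω) ∂P = (∑ a, Y (e a)) / Fintype.card α := by
  classical
  have hY : Measurable Y := Measurable.of_discrete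
  have h := hf.integral_comp (f := Y) hY.stronglyMeasurable.aestronglyMeasurable
  have hS : Set.range e = (Finset.univ.image e : Finset 𝓧) := by simp
  rw [Function.comp_def] at h
  rw [h, hS, uniformOn, ProbabilityTheory.cond, integral_smul_measure, setIntegral_finset,
    Finset.sum_image (fun _ _ _ _ h => he h), Measure.count_apply_finset,
    Finset.card_image_of_injective _ he]
  · simp [measureReal_def, div_eq_inv_mul]
  · rw [← Set.biUnion_of_singleton ((Finset.univ.image e : Finset 𝓧) : Set 𝓧)]
    refine (integrableOn_finite_biUnion (Finset.finite_toSet _)).mpr fun x _ => ?_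
    simp

/-- Almost surely only finitely many values occur, so the sum of their norms is a bound. -/
lemma memLp_of_hasLaw_uniformOn [IsProbabilityMeasure P]
    (hf : HasLaw f (uniformOn (Set.range e)) P) (Y : 𝓧 → ℝ) :
    MemLp (fun ω => Y (f ω)) 2 P := by
  have hY : Measurable Y := Measurable.of_discrete
  refine MemLp.of_bound (hY.comp_aemeasurable hf.aemeasurable).aestronglyMeasurable
    (∑ a, ‖Y (e a)‖) ?_
  filter_upwards [ae_mem_of_hasLaw_uniformOn hf] with ω hω
  obtain ⟨a, ha⟩ := hω
  rw [← ha]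
  exact Finset.single_le_sum (f := fun a => ‖Y (e a)‖) (fun _ _ => norm_nonneg _)
    (Finset.mem_univ a)

end UniformLaw

/-- The moments of `‖f‖₄⁴` for a law that parametrizes by uniform signs. -/
lemma moments_of_parametrization {Ω : Type*} [MeasurableSpace Ω] (P : Measure Ω)
    [IsProbabilityMeasure P] (n : ℕ) (hn : 1 < n) (f : Ω → ℂ[X])
    (e : (Fin ((n + 1) / 2) → ℤˣ) → ℂ[X]) (he : Function.Injective e)
    (hval : ∀ ε, lpNorm 4 (e ε) ^ 4 = (quartic n ε : ℤ))
    (hf : HasLaw f (uniformOn (Set.range e)) P) :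
    MemLp (fun ω => lpNorm 4 (f ω) ^ 4) 2 P ∧
    (∫ ω, lpNorm 4 (f ω) ^ 4 ∂P = 3 * (n : ℝ) ^ 2 - 3 * (n : ℝ) + (1 - (-1 : ℝ) ^ n) / 2) ∧
    (Even n → variance (fun ω => lpNorm 4 (f ω) ^ 4) P
        = 32 * (n : ℝ) ^ 3 - 216 * (n : ℝ) ^ 2 + 304 * (n : ℝ)
          + 256 * ((n / 6 : ℕ) : ℝ) + 256 * (if n % 6 = 4 then (1 : ℝ) else 0)) ∧
    (Odd n → variance (fun ω => lpNorm 4 (f ω) ^ 4) P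
        = 32 * (n : ℝ) ^ 3 - 144 * (n : ℝ) ^ 2 + 160 * (n : ℝ)
          - 576 * (((n - 1) / 4 : ℕ) : ℝ) - 512 * (((n - 1) / 6 : ℕ) : ℝ) - 48) := by
  have hL := memLp_of_hasLaw_uniformOn hf (fun g => lpNorm 4 g ^ 4)
  have hc : (Fintype.card (Fin ((n + 1) / 2) → ℤˣ) : ℝ) = 2 ^ ((n + 1) / 2) := by
    simp
  have h0 : (2 : ℝ) ^ ((n + 1) / 2) ≠ 0 := by positivity
  have h1 : ∫ ω, lpNorm 4 (f ω) ^ 4 ∂P = 3 * (n : ℝ) ^ 2 - 3 * n + (n % 2 : ℕ) := by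
    rw [integral_of_hasLaw_uniformOn he hf (fun g => lpNorm 4 g ^ 4), hc, div_eq_iff h0]
    simp only [hval]
    have := congrArg (Int.cast : ℤ → ℝ) (sum_quartic n hn)
    generalize n % 2 = b at this ⊢
    push_cast at this ⊢
    rw [this, mul_comm]
  have h2 : ∫ ω, (lpNorm 4 (f ω) ^ 4) ^ 2 ∂P =
      (((∑ ε, quartic n ε ^ 2 : ℤ)) : ℝ) / 2 ^ ((n + 1) / 2) := by
    rw [integral_of_hasLaw_uniformOn he hf (fun g => (lpNorm 4 g ^ 4) ^ 2), hc]
    simp only [hval]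
    push_cast
    rfl
  have hv : variance (fun ω => lpNorm 4 (f ω) ^ 4) P =
      (((∑ ε, quartic n ε ^ 2 : ℤ)) : ℝ) / 2 ^ ((n + 1) / 2)
        - (3 * (n : ℝ) ^ 2 - 3 * n + (n % 2 : ℕ)) ^ 2 := by
    rw [variance_eq_sub hL, ← h1, ← h2]
    rfl
  refine ⟨hL, ?_, fun hn2 => ?_, fun hn2 => ?_⟩
  · rw [h1]
    rcases n.even_or_odd with h | h
    · rw [h.neg_one_pow, Nat.even_iff.mp h]
      norm_num
    · rw [h.neg_one_pow, Nat.odd_iff.mp h]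
      norm_num
  · rw [hv, sum_quartic_sq_even n hn hn2, sub_eq_iff_eq_add, div_eq_iff h0]
    generalize n % 2 = b
    generalize n / 6 = c
    push_cast
    ring
  · rw [hv, sum_quartic_sq_odd n hn hn2, sub_eq_iff_eq_add, div_eq_iff h0]
    generalize n % 2 = b
    generalize (n - 1) / 4 = c
    generalize (n - 1) / 6 = d
    push_cast
    ring

end LittlewoodL4

theorem theorem3 {Ω : Type*} [MeasurableSpace Ω] (P : Measure Ω) [IsProbabilityMeasure P]
    (n : ℕ) (hn : 1 < n) (f : Ω → ℂ[X])
    (hf : HasLaw f (uniformOn (LittlewoodL4.reciprocal n)) P ∨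
      (Even n ∧ HasLaw f (uniformOn (LittlewoodL4.negReciprocal n)) P)) :
    MemLp (fun ω => LittlewoodL4.lpNorm 4 (f ω) ^ 4) 2 P ∧
    (∫ ω, LittlewoodL4.lpNorm 4 (f ω) ^ 4 ∂P
      = 3 * (n : ℝ) ^ 2 - 3 * (n : ℝ) + (1 - (-1 : ℝ) ^ n) / 2) ∧
    (Even n →
      variance (fun ω => LittlewoodL4.lpNorm 4 (f ω) ^ 4) P
        = 32 * (n : ℝ) ^ 3 - 216 * (n : ℝ) ^ 2 + 304 * (n : ℝ)
          + 256 * ((n / 6 : ℕ) : ℝ) + 256 * (if n % 6 = 4 then (1 : ℝ) else 0)) ∧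
    (Odd n →
      variance (fun ω => LittlewoodL4.lpNorm 4 (f ω) ^ 4) P
        = 32 * (n : ℝ) ^ 3 - 144 * (n : ℝ) ^ 2 + 160 * (n : ℝ)
          - 576 * (((n - 1) / 4 : ℕ) : ℝ) - 512 * (((n - 1) / 6 : ℕ) : ℝ) - 48) := by
  rcases hf with hf | ⟨he, hf⟩
  · rw [← LittlewoodL4.range_recPoly n hn] at hf
    exact LittlewoodL4.moments_of_parametrization P n hn f _ (LittlewoodL4.recPoly_injective n)
      (LittlewoodL4.lpNorm_recPoly n) hf
  · rw [← LittlewoodL4.range_recPoly_comp_neg_X n hn he] at hf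
    refine LittlewoodL4.moments_of_parametrization P n hn f _
      (LittlewoodL4.recPoly_comp_neg_X_injective n) (fun ε => ?_) hf
    rw [LittlewoodL4.lpNorm_four_pow_comp_neg_X, LittlewoodL4.lpNorm_recPoly]
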